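/- A commutative semiring $(S,+,\cdot,0,1)$ is naturally ordered by $s\le t :\Leftrightarrow \exists r\,(s+r=t)$. Let $S$ be one of the following semirings: the Viterbi semiring $([0,1],\max,\cdot,0,1)$; the tropical semiring $([0,\infty],\min,+,\infty,0)$; the Łukasiewicz semiring $([0,1],\max,\odot,0,1)$ with $s\odot t=\max(s+t-1,0)$; the semiring of doubt $([0,1],\min,\oplus,1,0)$ with $s\oplus t=\min(s+t,1)$. Let $\tau$ be a relational vocabulary. Formulae are first-order formulae (with equality) in negation normal form. A finite $S$-interpretation $\pi$ with finite non-empty universe $A$ assigns a value $\pi(\ell)\in S$ to every literal $R\bar a$ or $\neg R\bar a$ with $R\in\tau$ and $\bar a$ a tuple from $A$, such that for all $R,\bar a$ precisely one of $\pi(R\bar a)$, $\pi(\neg R\bar a)$ is $0$. It extends to all formulae instantiated in $A$ by $\pi[\![\psi\vee\theta]\!]=\pi[\![\psi]\!]+\pi[\![\theta]\!]$, $\pi[\![\psi\wedge\theta]\!]=\pi[\![\psi]\!]\cdot\pi[\![\theta]\!]$, $\pi[\![\exists x\,\psi(x)]\!]=\sum_{a\in A}\pi[\![\psi(a)]\!]$,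 $\pi[\![\forall x\,\psi(x)]\!]=\prod_{a\in A}\pi[\![\psi(a)]\!]$, where equalities, inequalities and the Boolean constants $\top,\bot$ take their truth value in $\{0,1\}\subseteq S$. For $S$-interpretations $\pi_A,\pi_B$ with universes $A\subseteq B$, $\pi_B$ is an extension of $\pi_A$ if the two agree on all literals over $A$. Theorem. For every first-order $\tau$-sentence $\psi$ the following are equivalent: (1) $\psi$ is preserved under extensions on finite $S$-interpretations, i.e. $\pi_A[\![\psi]\!]\le\pi_B[\![\psi]\!]$ in the natural order of $S$ for all finite $S$-interpretations $\pi_A,\pi_B$ such that $\pi_B$ is an extension of $\pi_A$; (2) there is an existential sentence $\varphi=\exists x_1\dots\exists x_k\,\vartheta(x_1,\dots,x_k)$, with $\vartheta$ quantifier-free, such that $\pi[\![\psi]\!]=\pi[\![\varphi]\!]$ for all finite $S$-interpretations $\pi$. -/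

import Mathlib

open scoped ENNReal

universe w u v s

/-! ## The four semirings -/

/-- The Viterbi semiring `([0,1], max, ·, 0, 1)`. -/
def Viterbi : Type := Set.Icc (0 : ℝ) 1

noncomputable instance : Add Viterbi where
  add s t := ⟨max s.1 t.1, le_max_of_le_left s.2.1, max_le s.2.2 t.2.2⟩

instance : Zero Viterbi where
  zero := ⟨0, le_refl _, zero_le_one⟩

noncomputable instance : CommSemiring Viterbi where
  mul s t := ⟨s.1 * t.1, mul_nonneg s.2.1 t.2.1, mul_le_one₀ s.2.2 t.2.1 t.2.2⟩
  one := ⟨1, zero_le_one, le_refl _⟩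
  nsmul := nsmulRec
  add_assoc _ _ _ := Subtype.ext (max_assoc _ _ _)
  add_comm _ _ := Subtype.ext (max_comm _ _)
  zero_add s := Subtype.ext (max_eq_right s.2.1)
  add_zero s := Subtype.ext (max_eq_left s.2.1)
  mul_assoc _ _ _ := Subtype.ext (mul_assoc _ _ _)
  mul_comm _ _ := Subtype.ext (mul_comm _ _)
  one_mul _ := Subtype.ext (one_mul _)
  mul_one _ := Subtype.ext (mul_one _)
  zero_mul _ := Subtype.ext (zero_mul _)
  mul_zero _ := Subtype.ext (mul_zero _)
  left_distrib s _ _ := Subtype.ext (mul_max_of_nonneg _ _ s.2.1)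
  right_distrib _ _ u := Subtype.ext (max_mul_of_nonneg _ _ u.2.1)

/-- The tropical semiring `([0,∞], min, +, ∞, 0)`. -/
abbrev TropicalSemiring : Type := Tropical ℝ≥0∞

/-- The Łukasiewicz semiring `([0,1], max, ⊙, 0, 1)` with `s ⊙ t = max (s + t - 1) 0`. -/
def Lukasiewicz : Type := Set.Icc (0 : ℝ) 1

noncomputable instance : Add Lukasiewicz where
  add s t := ⟨max s.1 t.1, le_max_of_le_left s.2.1, max_le s.2.2 t.2.2⟩

instance : Zero Lukasiewicz where
  zero := ⟨0, le_refl _, zero_le_one⟩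

noncomputable instance : CommSemiring Lukasiewicz where
  mul s t := ⟨max (s.1 + t.1 - 1) 0, le_max_right _ _,
    max_le (by linarith [s.2.2, t.2.2]) zero_le_one⟩
  one := ⟨1, zero_le_one, le_refl _⟩
  nsmul := nsmulRec
  add_assoc _ _ _ := Subtype.ext (max_assoc _ _ _)
  add_comm _ _ := Subtype.ext (max_comm _ _)
  zero_add s := Subtype.ext (max_eq_right s.2.1)
  add_zero s := Subtype.ext (max_eq_left s.2.1)
  mul_assoc := by
    rintro ⟨s, _, _⟩ ⟨t, _, _⟩ ⟨u, _, _⟩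
    refine Subtype.ext ?_
    change max (max (s + t - 1) 0 + u - 1) 0 = max (s + max (t + u - 1) 0 - 1) 0
    grind
  mul_comm := by
    rintro ⟨s, _, _⟩ ⟨t, _, _⟩
    refine Subtype.ext ?_
    change max (s + t - 1) 0 = max (t + s - 1) 0
    rw [add_comm]
  one_mul := by
    rintro ⟨s, _, _⟩
    refine Subtype.ext ?_
    change max (1 + s - 1) 0 = s
    grind
  mul_one := by
    rintro ⟨s, _, _⟩
    refine Subtype.ext ?_
    change max (s + 1 - 1) 0 = s
    grind
  zero_mul := by
    rintro ⟨s, _, _⟩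
    refine Subtype.ext ?_
    change max (0 + s - 1) 0 = 0
    grind
  mul_zero := by
    rintro ⟨s, _, _⟩
    refine Subtype.ext ?_
    change max (s + 0 - 1) 0 = 0
    grind
  left_distrib := by
    rintro ⟨s, _, _⟩ ⟨t, _, _⟩ ⟨u, _, _⟩
    refine Subtype.ext ?_
    change max (s + max t u - 1) 0 = max (max (s + t - 1) 0) (max (s + u - 1) 0)
    grind
  right_distrib := by
    rintro ⟨s, _, _⟩ ⟨t, _, _⟩ ⟨u, _, _⟩
    refine Subtype.ext ?_
    change max (max s t + u - 1) 0 = max (max (s + u - 1) 0) (max (t + u - 1) 0)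
    grind

/-- The semiring of doubt `([0,1], min, ⊕, 1, 0)` with `s ⊕ t = min (s + t) 1`. -/
def Doubt : Type := Set.Icc (0 : ℝ) 1

noncomputable instance : Add Doubt where
  add s t := ⟨min s.1 t.1, le_min s.2.1 t.2.1, min_le_of_left_le s.2.2⟩

instance : Zero Doubt where
  zero := ⟨1, zero_le_one, le_refl _⟩

noncomputable instance : CommSemiring Doubt where
  mul s t := ⟨min (s.1 + t.1) 1, le_min (add_nonneg s.2.1 t.2.1) zero_le_one, min_le_right _ _⟩
  one := ⟨0, le_refl _, zero_le_one⟩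
  nsmul := nsmulRec
  add_assoc _ _ _ := Subtype.ext (min_assoc _ _ _)
  add_comm _ _ := Subtype.ext (min_comm _ _)
  zero_add s := Subtype.ext (min_eq_right s.2.2)
  add_zero s := Subtype.ext (min_eq_left s.2.2)
  mul_assoc := by
    rintro ⟨s, _, _⟩ ⟨t, _, _⟩ ⟨u, _, _⟩
    refine Subtype.ext ?_
    change min (min (s + t) 1 + u) 1 = min (s + min (t + u) 1) 1
    grind
  mul_comm := by
    rintro ⟨s, _, _⟩ ⟨t, _, _⟩
    refine Subtype.ext ?_
    change min (s + t) 1 = min (t + s) 1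
    rw [add_comm]
  one_mul := by
    rintro ⟨s, _, _⟩
    refine Subtype.ext ?_
    change min (0 + s) 1 = s
    grind
  mul_one := by
    rintro ⟨s, _, _⟩
    refine Subtype.ext ?_
    change min (s + 0) 1 = s
    grind
  zero_mul := by
    rintro ⟨s, _, _⟩
    refine Subtype.ext ?_
    change min (1 + s) 1 = 1
    grind
  mul_zero := by
    rintro ⟨s, _, _⟩
    refine Subtype.ext ?_
    change min (s + 1) 1 = 1
    grind
  left_distrib := by
    rintro ⟨s, _, _⟩ ⟨t, _, _⟩ ⟨u, _, _⟩
    refine Subtype.ext ?_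
    change min (s + min t u) 1 = min (min (s + t) 1) (min (s + u) 1)
    grind
  right_distrib := by
    rintro ⟨s, _, _⟩ ⟨t, _, _⟩ ⟨u, _, _⟩
    refine Subtype.ext ?_
    change min (min s t + u) 1 = min (min (s + u) 1) (min (t + u) 1)
    grind

/-- The natural order of a semiring: `s ≤ t` iff `s + r = t` for some `r`. -/
def NatLE {S : Type*} [CommSemiring S] (s t : S) : Prop := ∃ r, s + r = t

/-! ## First-order logic in negation normal form -/

/-- First-order formulae in negation normal form over the relation symbols of `L`, with free
variables among `x₀, …, xₙ₋₁`. In `ex φ` and `all φ` the quantifier binds the last variable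
`xₙ` of `φ`. -/
inductive NNF (L : FirstOrder.Language) : ℕ → Type _
  | top {n : ℕ} : NNF L n
  | bot {n : ℕ} : NNF L n
  | eq {n : ℕ} (i j : Fin n) : NNF L n
  | ne {n : ℕ} (i j : Fin n) : NNF L n
  | rel {n k : ℕ} (R : L.Relations k) (x : Fin k → Fin n) : NNF L n
  | nrel {n k : ℕ} (R : L.Relations k) (x : Fin k → Fin n) : NNF L n
  | or {n : ℕ} (φ θ : NNF L n) : NNF L n
  | and {n : ℕ} (φ θ : NNF L n) : NNF L n
  | ex {n : ℕ} (φ : NNF L (n + 1)) : NNF L n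
  | all {n : ℕ} (φ : NNF L (n + 1)) : NNF L n

/-- The formula contains no quantifier. -/
def NNF.QuantifierFree {L : FirstOrder.Language} : {n : ℕ} → NNF L n → Prop
  | _, .top => True
  | _, .bot => True
  | _, .eq _ _ => True
  | _, .ne _ _ => True
  | _, .rel _ _ => True
  | _, .nrel _ _ => True
  | _, .or φ θ => φ.QuantifierFree ∧ θ.QuantifierFree
  | _, .and φ θ => φ.QuantifierFree ∧ θ.QuantifierFree
  | _, .ex _ => False
  | _, .all _ => False

/-- `Σ₁`: a (possibly empty) block of existential quantifiers followed by a quantifier-free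
formula. -/
inductive NNF.IsSigma1 {L : FirstOrder.Language} : {n : ℕ} → NNF L n → Prop
  | of_quantifierFree {n : ℕ} {φ : NNF L n} : φ.QuantifierFree → NNF.IsSigma1 φ
  | ex {n : ℕ} {φ : NNF L (n + 1)} : NNF.IsSigma1 φ → NNF.IsSigma1 (NNF.ex φ)

/-! ## Semiring semantics -/

/-- An `S`-interpretation with universe `A`: `pos R a` is the value of the literal `R a` and
`neg R a` is the value of the literal `¬ R a`. -/
structure Interp (L : FirstOrder.Language) (S : Type*) (A : Type*) where
  pos : {k : ℕ} → L.Relations k → (Fin k → A) → S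
  neg : {k : ℕ} → L.Relations k → (Fin k → A) → S

namespace Interp

/-- Of any two complementary literals, precisely one has value `0`. -/
def ModelDefining {L : FirstOrder.Language} {S A : Type*} [CommSemiring S]
    (π : Interp L S A) : Prop :=
  ∀ (k : ℕ) (R : L.Relations k) (a : Fin k → A), Xor (π.pos R a = 0) (π.neg R a = 0)

open Classical in
/-- The value in the semiring `S` of a formula whose free variables are instantiated by `a`. -/
noncomputable def eval {L : FirstOrder.Language} {S A : Type*} [CommSemiring S] [Fintype A]
    (π : Interp L S A) : {n : ℕ} → NNF L n → (Fin n → A) → S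
  | _, .top, _ => 1
  | _, .bot, _ => 0
  | _, .eq i j, a => if a i = a j then 1 else 0
  | _, .ne i j, a => if a i = a j then 0 else 1
  | _, .rel R x, a => π.pos R (a ∘ x)
  | _, .nrel R x, a => π.neg R (a ∘ x)
  | _, .or φ θ, a => π.eval φ a + π.eval θ a
  | _, .and φ θ, a => π.eval φ a * π.eval θ a
  | _, .ex φ, a => ∑ b : A, π.eval φ (Fin.snoc a b)
  | _, .all φ, a => ∏ b : A, π.eval φ (Fin.snoc a b)

/-- The value of a sentence. -/
noncomputable def value {L : FirstOrder.Language} {S A : Type*} [CommSemiring S] [Fintype A]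
    (π : Interp L S A) (ψ : NNF L 0) : S :=
  π.eval ψ Fin.elim0

/-- `πA ⊆ πB`, where the universe of `πA` is the subset `A` of the universe of `πB`: both
interpretations agree on all literals over `A`. -/
def IsSubinterpretation {L : FirstOrder.Language} {S B : Type*} {A : Finset B}
    (πA : Interp L S A) (πB : Interp L S B) : Prop :=
  ∀ (k : ℕ) (R : L.Relations k) (a : Fin k → A),
    πA.pos R a = πB.pos R (fun i => (a i : B)) ∧ πA.neg R a = πB.neg R (fun i => (a i : B))

end Interp

/-- `ψ` is preserved under extensions on finite model-defining `S`-interpretations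
(with non-empty universes). -/
def FinExtPreserved {L : FirstOrder.Language.{u, v}} (S : Type s) [CommSemiring S]
    (ψ : NNF L 0) : Prop :=
  ∀ (B : Type w) [Fintype B] (A : Finset B) (πA : Interp L S A) (πB : Interp L S B),
    A.Nonempty → πA.ModelDefining → πB.ModelDefining → πA.IsSubinterpretation πB →
    NatLE (πA.value ψ) (πB.value ψ)

/-- `ψ` and `φ` have the same value in all finite model-defining `S`-interpretations
(with non-empty universes). -/
def FinEquiv {L : FirstOrder.Language.{u, v}} (S : Type s) [CommSemiring S]
    (ψ φ : NNF L 0) : Prop :=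
  ∀ (A : Type w) [Fintype A] [Nonempty A] (π : Interp L S A),
    π.ModelDefining → π.value ψ = π.value φ

/-! In all four semirings addition is the maximum of the natural order, `1` is the top element,
powers of any `v < 1` become arbitrarily small, and multiplication by some `v < 1` can be made to
cost arbitrarily little. These properties, collected in `MaxSemiring`, are all that the proof uses.

The hard direction needs a bound `K`, depending only on `ψ`, such that the value of `ψ` in any
finite interpretation is already reached in a subinterpretation with at most `K` elements
(`exists_small_le`). Then `ψ` is equivalent to `∃ x₁ … x_K` applied to the disjunction, over
nonempty `J ⊆ {1, …, K}`, of `ψ` with its quantifiers restricted to the `x_j`, `j ∈ J`. Repeated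
values among these `x_j` do no harm: they only add factors `≤ 1` to products.

The bound rests on `exists_witness_finset`. Suppose that all literals are at most `v < 1` and that
the universe is so large that a product of that many factors `≤ v` lies below the value of the
formula. In a universal quantification some element outside the current parameters must then
contribute exactly `1`. A value `1` is due to equalities alone, so every fresh element contributes
`1`, and the quantifier really speaks only about the parameters. Hence boundedly many elements
witness the value.

Both suppositions can be arranged. Preservation allows padding the universe with dummy elements
whose nonzero literals lie below the value and so cannot affect it (`exists_small_le_of_lt_one`).
Literals can be capped at `v` close to `1` at a cost of `v ^ m` with `m` independent of `v`; as
there are finitely many small subinterpretations, the best of them cannot fall short of the true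
value by a fixed gap. -/

/-- A semiring whose addition is the maximum of a linear order with top element `1`, together with
the density and Archimedean properties shared by the four semirings considered here. -/
class MaxSemiring (S : Type*) [CommSemiring S] [LinearOrder S] : Prop where
  add_eq_max (s t : S) : s + t = max s t
  le_one' (s : S) : s ≤ 1
  exists_pos_lt (c : S) : c ≠ 0 → ∃ u, u ≠ 0 ∧ u < c
  exists_pow_lt (v c : S) : v < 1 → c ≠ 0 → ∃ n : ℕ, v ^ n < c
  exists_lt_mul (d c : S) : d < c → ∃ v, v < 1 ∧ d < v * c

/-! ### The four semirings are instances -/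

noncomputable instance : LinearOrder Viterbi :=
  LinearOrder.lift' (fun x : Viterbi => x.1) Subtype.val_injective

noncomputable instance : LinearOrder Lukasiewicz :=
  LinearOrder.lift' (fun x : Lukasiewicz => x.1) Subtype.val_injective

noncomputable instance : LinearOrder Doubt :=
  LinearOrder.lift' (fun x : Doubt => OrderDual.toDual x.1)
    (fun _ _ h => Subtype.ext (OrderDual.toDual.injective h))

/-- The tropical semiring, to be ordered by its natural order, which reverses the order of
`Tropical ℝ≥0∞`. -/
def NaturalTropical : Type := Tropical ℝ≥0∞

noncomputable instance : CommSemiring NaturalTropical :=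
  inferInstanceAs (CommSemiring (Tropical ℝ≥0∞))

noncomputable instance : LinearOrder NaturalTropical :=
  LinearOrder.lift' (fun x : NaturalTropical => OrderDual.toDual (Tropical.untrop x))
    (fun _ _ h => Tropical.untrop_injective (OrderDual.toDual.injective h))

theorem Viterbi.lt_iff {s t : Viterbi} : s < t ↔ s.1 < t.1 := Iff.rfl

theorem Lukasiewicz.lt_iff {s t : Lukasiewicz} : s < t ↔ s.1 < t.1 := Iff.rfl

theorem Doubt.lt_iff {s t : Doubt} : s < t ↔ t.1 < s.1 := Iff.rfl

theorem NaturalTropical.lt_iff {s t : NaturalTropical} :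
    s < t ↔ Tropical.untrop t < Tropical.untrop s := Iff.rfl

theorem Viterbi.pow_val (s : Viterbi) (n : ℕ) : (s ^ n).1 = s.1 ^ n := by
  induction n with
  | zero => rfl
  | succ n ih => rw [pow_succ, pow_succ, ← ih]; rfl

/-- Each factor `s` subtracts `1 - s` until truncation at `0`; an upper bound suffices for the
Archimedean property. -/
theorem Lukasiewicz.pow_val_le (s : Lukasiewicz) (n : ℕ) :
    (s ^ n).1 ≤ max (1 - n * (1 - s.1)) 0 := by
  induction n with
  | zero => exact le_max_of_le_left (by simp; exact (s ^ 0).2.2)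
  | succ n ih =>
    rw [pow_succ]
    change max ((s ^ n).1 + s.1 - 1) 0 ≤ _
    have := s.2.2
    push_cast
    grind

theorem Doubt.le_pow_val (s : Doubt) (n : ℕ) : min (n * s.1) 1 ≤ (s ^ n).1 := by
  induction n with
  | zero => exact min_le_of_left_le (by simp; exact (s ^ 0).2.1)
  | succ n ih =>
    rw [pow_succ]
    change _ ≤ min ((s ^ n).1 + s.1) 1
    have := s.2.1
    push_cast
    grind

instance : MaxSemiring Viterbi where
  add_eq_max s t := by
    rcases le_total s t with h | h
    · rw [max_eq_right h]; exact Subtype.ext (max_eq_right h)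
    · rw [max_eq_left h]; exact Subtype.ext (max_eq_left h)
  le_one' s := s.2.2
  exists_pos_lt c hc := by
    have h0 : 0 < c.1 := lt_of_le_of_ne c.2.1 fun h => hc (Subtype.ext h.symm)
    refine ⟨⟨c.1 / 2, by linarith, by linarith [c.2.2]⟩, fun h => ?_, ?_⟩
    · have : c.1 / 2 = 0 := congrArg Subtype.val h
      linarith
    · refine Viterbi.lt_iff.2 ?_; dsimp only; linarith
  exists_pow_lt v c hv hc := by
    have h0 : 0 < c.1 := lt_of_le_of_ne c.2.1 fun h => hc (Subtype.ext h.symm)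
    obtain ⟨n, hn⟩ := exists_pow_lt_of_lt_one h0 (Viterbi.lt_iff.1 hv)
    exact ⟨n, by rwa [Viterbi.lt_iff, Viterbi.pow_val]⟩
  exists_lt_mul d c h := by
    rw [Viterbi.lt_iff] at h
    have hd := d.2.1
    have hc : 0 < c.1 := by linarith
    -- Chosen so that `v * c` is the midpoint of `d` and `c`; the Łukasiewicz and doubt witnesses
    -- below follow the same principle.
    refine ⟨⟨(d.1 + c.1) / 2 / c.1, by positivity, ?_⟩, ?_, ?_⟩
    · rw [div_le_one hc]; linarith
    · refine Viterbi.lt_iff.2 ?_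
      change (d.1 + c.1) / 2 / c.1 < 1
      rw [div_lt_one hc]; linarith
    · refine Viterbi.lt_iff.2 ?_
      change d.1 < (d.1 + c.1) / 2 / c.1 * c.1
      rw [div_mul_cancel₀ _ hc.ne']; linarith

instance : MaxSemiring Lukasiewicz where
  add_eq_max s t := by
    rcases le_total s t with h | h
    · rw [max_eq_right h]; exact Subtype.ext (max_eq_right h)
    · rw [max_eq_left h]; exact Subtype.ext (max_eq_left h)
  le_one' s := s.2.2
  exists_pos_lt c hc := by
    have h0 : 0 < c.1 := lt_of_le_of_ne c.2.1 fun h => hc (Subtype.ext h.symm)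
    refine ⟨⟨c.1 / 2, by linarith, by linarith [c.2.2]⟩, fun h => ?_, ?_⟩
    · have : c.1 / 2 = 0 := congrArg Subtype.val h
      linarith
    · refine Lukasiewicz.lt_iff.2 ?_; dsimp only; linarith
  exists_pow_lt v c hv hc := by
    have h0 : 0 < c.1 := lt_of_le_of_ne c.2.1 fun h => hc (Subtype.ext h.symm)
    have hv' : 0 < 1 - v.1 := sub_pos.2 (Lukasiewicz.lt_iff.1 hv)
    obtain ⟨n, hn⟩ := exists_nat_gt (1 / (1 - v.1))
    rw [div_lt_iff₀ hv'] at hn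
    refine ⟨n, Lukasiewicz.lt_iff.2 (lt_of_le_of_lt (Lukasiewicz.pow_val_le v n) ?_)⟩
    exact max_lt (by linarith) h0
  exists_lt_mul d c h := by
    rw [Lukasiewicz.lt_iff] at h
    have hd := d.2.1
    have hc := c.2.2
    refine ⟨⟨1 - (c.1 - d.1) / 2, by linarith, by linarith⟩, ?_, ?_⟩
    · refine Lukasiewicz.lt_iff.2 ?_
      change 1 - (c.1 - d.1) / 2 < 1
      linarith
    · refine Lukasiewicz.lt_iff.2 ?_
      exact lt_max_of_lt_left (by dsimp only; linarith)

instance : MaxSemiring Doubt where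
  add_eq_max s t := by
    rcases le_total s t with h | h
    · rw [max_eq_right h]; exact Subtype.ext (min_eq_right h)
    · rw [max_eq_left h]; exact Subtype.ext (min_eq_left h)
  le_one' s := s.2.1
  exists_pos_lt c hc := by
    have h0 : c.1 < 1 := lt_of_le_of_ne c.2.2 fun h => hc (Subtype.ext h)
    have := c.2.1
    refine ⟨⟨(1 + c.1) / 2, by linarith, by linarith⟩, fun h => ?_, ?_⟩
    · have : (1 + c.1) / 2 = 1 := congrArg Subtype.val h
      linarith
    · refine Doubt.lt_iff.2 ?_; dsimp only; linarith
  exists_pow_lt v c hv hc := by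
    have h0 : c.1 < 1 := lt_of_le_of_ne c.2.2 fun h => hc (Subtype.ext h)
    have hv' : 0 < v.1 := Doubt.lt_iff.1 hv
    obtain ⟨n, hn⟩ := exists_nat_gt (1 / v.1)
    rw [div_lt_iff₀ hv'] at hn
    refine ⟨n, Doubt.lt_iff.2 (lt_of_lt_of_le ?_ (Doubt.le_pow_val v n))⟩
    exact lt_min (by linarith) h0
  exists_lt_mul d c h := by
    rw [Doubt.lt_iff] at h
    have hd := d.2.2
    have hc := c.2.1
    refine ⟨⟨(d.1 - c.1) / 2, by linarith, by linarith⟩, ?_, ?_⟩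
    · refine Doubt.lt_iff.2 ?_
      change 0 < (d.1 - c.1) / 2
      linarith
    · refine Doubt.lt_iff.2 ?_
      exact min_lt_of_left_lt (by dsimp only; linarith)

instance : MaxSemiring NaturalTropical where
  add_eq_max s t := by
    rcases le_total s t with h | h
    · rw [max_eq_right h]; exact Tropical.untrop_injective (min_eq_right h)
    · rw [max_eq_left h]; exact Tropical.untrop_injective (min_eq_left h)
  le_one' s := zero_le (a := Tropical.untrop s)
  exists_pos_lt c hc := by
    have h0 : Tropical.untrop c < ⊤ :=
      lt_top_iff_ne_top.2 fun h => hc (Tropical.untrop_injective h)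
    obtain ⟨u, hu, hu'⟩ := exists_between h0
    exact ⟨Tropical.trop u, fun h => hu'.ne (congrArg Tropical.untrop h), hu⟩
  exists_pow_lt v c hv hc := by
    have h0 : Tropical.untrop c ≠ ⊤ := fun h => hc (Tropical.untrop_injective h)
    have hv' : Tropical.untrop v ≠ 0 := (NaturalTropical.lt_iff.1 hv).ne'
    obtain ⟨n, hn⟩ := ENNReal.exists_nat_mul_gt hv' h0
    refine ⟨n, NaturalTropical.lt_iff.2 (hn.trans_eq ?_)⟩
    rw [← nsmul_eq_mul]
    exact (Tropical.untrop_pow (R := ℝ≥0∞) v n).symm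
  exists_lt_mul d c h := by
    obtain ⟨r, hr, h'⟩ := ENNReal.lt_iff_exists_add_pos_lt.1 (NaturalTropical.lt_iff.1 h)
    refine ⟨Tropical.trop (r : ℝ≥0∞), NaturalTropical.lt_iff.2 (ENNReal.coe_pos.2 hr),
      NaturalTropical.lt_iff.2 ?_⟩
    rw [add_comm] at h'
    exact h'

/-! ### Sums and products in a max-semiring -/

namespace MaxSemiring

section

variable {S : Type*} [CommSemiring S] [LinearOrder S] [MaxSemiring S]

theorem zero_le_self (s : S) : 0 ≤ s := by
  rw [← max_eq_right_iff, ← add_eq_max, zero_add]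

/-- Since `a ≤ b` means `a + b = b`, monotonicity of multiplication is distributivity. -/
theorem mul_le_mul_right'' {a b : S} (h : a ≤ b) (c : S) : c * a ≤ c * b := by
  rw [← max_eq_right_iff, ← add_eq_max] at h ⊢
  rw [← mul_add, h]

instance : IsOrderedMonoid S where
  mul_le_mul_left a b h c := by
    rw [mul_comm a, mul_comm b]
    exact mul_le_mul_right'' h c

theorem natLE_iff {s t : S} : NatLE s t ↔ s ≤ t := by
  constructor
  · rintro ⟨r, rfl⟩
    rw [add_eq_max]
    exact le_max_left _ _
  · intro h
    exact ⟨t, by rw [add_eq_max, max_eq_right h]⟩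

theorem sum_le {ι : Type*} {A : Finset ι} {f : ι → S} {t : S} (h : ∀ a ∈ A, f a ≤ t) :
    ∑ a ∈ A, f a ≤ t := by
  classical
  induction A using Finset.induction_on with
  | empty => simpa using zero_le_self t
  | insert a A ha ih =>
    rw [Finset.sum_insert ha, add_eq_max]
    exact max_le (h a (by simp)) (ih fun b hb => h b (by simp [hb]))

theorem le_sum {ι : Type*} {A : Finset ι} (f : ι → S) {a : ι} (ha : a ∈ A) :
    f a ≤ ∑ a ∈ A, f a := by
  classical
  rw [← Finset.add_sum_erase A f ha, add_eq_max]
  exact le_max_left _ _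

theorem exists_sum_le {ι : Type*} {A : Finset ι} (hA : A.Nonempty) (f : ι → S) :
    ∃ a ∈ A, ∑ a ∈ A, f a ≤ f a := by
  obtain ⟨a, ha, h⟩ := A.exists_max_image f hA
  exact ⟨a, ha, sum_le h⟩

/-- A maximum is attained; the nonzero lower bound rules out the empty index set. -/
theorem exists_mem_le_of_le_sum {ι : Type*} {A : Finset ι} {f : ι → S} {c : S} (hc : c ≠ 0)
    (h : c ≤ ∑ a ∈ A, f a) : ∃ a ∈ A, ∑ a ∈ A, f a ≤ f a := by
  rcases A.eq_empty_or_nonempty with rfl | hA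
  · exact absurd (le_antisymm (by simpa using h) (zero_le_self c)) hc
  · exact exists_sum_le hA f

theorem prod_le {ι : Type*} {A : Finset ι} (f : ι → S) {a : ι} (ha : a ∈ A) :
    ∏ a ∈ A, f a ≤ f a := by
  classical
  rw [← Finset.mul_prod_erase A f ha]
  exact mul_le_of_le_one_right' (le_one' _)

theorem prod_le_prod_of_subset {ι : Type*} {A B : Finset ι} (f : ι → S) (h : A ⊆ B) :
    ∏ a ∈ B, f a ≤ ∏ a ∈ A, f a := by
  classical
  rw [← Finset.prod_sdiff h]
  exact mul_le_of_le_one_left' (le_one' _)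

theorem mul_le_left (a b : S) : a * b ≤ a := mul_le_of_le_one_right' (le_one' _)

theorem mul_le_right (a b : S) : a * b ≤ b := mul_le_of_le_one_left' (le_one' _)

/-- The gap between `d` and `c` is used up one factor at a time, and the largest of the `v`'s
obtained serves for all factors. -/
theorem exists_lt_pow_mul {d c : S} (h : d < c) (n : ℕ) : ∃ v, v < 1 ∧ d < v ^ n * c := by
  induction n with
  | zero =>
    obtain ⟨v, hv, -⟩ := exists_lt_mul d c h
    exact ⟨v, hv, by simpa using h⟩
  | succ n ih =>
    obtain ⟨v, hv, hd⟩ := ih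
    obtain ⟨v', hv', hd'⟩ := exists_lt_mul _ _ hd
    refine ⟨max v v', max_lt hv hv', hd'.trans_le ?_⟩
    rw [pow_succ', mul_assoc]
    exact mul_le_mul' (le_max_right _ _)
      (mul_le_mul' (pow_le_pow_left' (le_max_left _ _) _) le_rfl)

end

end MaxSemiring

/-! ### Transporting interpretations -/

namespace Interp

open MaxSemiring

variable {L : FirstOrder.Language.{u, v}} {S : Type*} {A B : Type*}

/-- The interpretation on `A` induced by a map `A → B` and an interpretation on `B`. -/
def comap (f : A → B) (π : Interp L S B) : Interp L S A where
  pos R a := π.pos R (f ∘ a)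
  neg R a := π.neg R (f ∘ a)

/-- The interpretation in which all literals are false. -/
def zero [Zero S] : Interp L S A where
  pos _ _ := 0
  neg _ _ := 0

theorem comap_modelDefining [CommSemiring S] {π : Interp L S B} (h : π.ModelDefining)
    (f : A → B) : (π.comap f).ModelDefining := fun k R a => h k R (f ∘ a)

theorem comap_isSubinterpretation {B : Type*} (π : Interp L S B) (A : Finset B) :
    (π.comap ((↑) : A → B)).IsSubinterpretation π := fun _ _ _ => ⟨rfl, rfl⟩

theorem IsSubinterpretation.eq_comap {B : Type*} {A : Finset B} {πA : Interp L S A}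
    {πB : Interp L S B} (h : πA.IsSubinterpretation πB) : πA = πB.comap (↑) := by
  cases πA
  simp only [comap, Interp.mk.injEq]
  exact ⟨by funext k R a; exact (h k R a).1, by funext k R a; exact (h k R a).2⟩

theorem snoc_comp (f : A → B) {n : ℕ} (a : Fin n → A) (b : A) :
    (Fin.snoc (f ∘ a) (f b) : Fin (n + 1) → B) = f ∘ (Fin.snoc a b : Fin (n + 1) → A) :=
  (Fin.comp_snoc f a b).symm

theorem eval_comap_equiv [CommSemiring S] [Fintype A] [Fintype B] (π : Interp L S B) (e : A ≃ B)
    {n : ℕ} (φ : NNF L n) (a : Fin n → A) :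
    (π.comap e).eval φ a = π.eval φ (e ∘ a) := by
  induction φ with
  | top => simp [eval]
  | bot => simp [eval]
  | eq i j => classical exact if_congr e.injective.eq_iff.symm rfl rfl
  | ne i j => classical exact if_congr e.injective.eq_iff.symm rfl rfl
  | rel R x => simp [eval, comap, Function.comp_assoc]
  | nrel R x => simp [eval, comap, Function.comp_assoc]
  | or φ θ h1 h2 => simp [eval, h1, h2]
  | and φ θ h1 h2 => simp [eval, h1, h2]
  | ex φ ih =>
    simp only [eval, ih, ← snoc_comp]
    exact Equiv.sum_comp e fun b => π.eval φ (Fin.snoc (e ∘ a) b)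
  | all φ ih =>
    simp only [eval, ih, ← snoc_comp]
    exact Equiv.prod_comp e fun b => π.eval φ (Fin.snoc (e ∘ a) b)

theorem value_comap_equiv [CommSemiring S] [Fintype A] [Fintype B] (π : Interp L S B) (e : A ≃ B)
    (φ : NNF L 0) : (π.comap e).value φ = π.value φ := by
  rw [value, eval_comap_equiv, value]
  congr 1
  exact Subsingleton.elim _ _

theorem eval_comap_of_quantifierFree [CommSemiring S] [Fintype A] [Fintype B]
    (π : Interp L S B) {f : A → B}
    (hf : f.Injective) {n : ℕ} {φ : NNF L n} (hφ : φ.QuantifierFree) (a : Fin n → A) :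
    (π.comap f).eval φ a = π.eval φ (f ∘ a) := by
  induction φ with
  | top => simp [eval]
  | bot => simp [eval]
  | eq i j => classical exact if_congr hf.eq_iff.symm rfl rfl
  | ne i j => classical exact if_congr hf.eq_iff.symm rfl rfl
  | rel R x => simp [eval, comap, Function.comp_assoc]
  | nrel R x => simp [eval, comap, Function.comp_assoc]
  | or φ θ h1 h2 => simp [eval, h1 hφ.1, h2 hφ.2]
  | and φ θ h1 h2 => simp [eval, h1 hφ.1, h2 hφ.2]
  | ex φ ih => exact hφ.elim
  | all φ ih => exact hφ.elim

/-! ### Dependence of values on the literals: thresholds, monotonicity and capping -/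

variable [CommSemiring S] [LinearOrder S] [MaxSemiring S]

theorem eval_comap_le_of_isSigma1 [Fintype A] [Fintype B] (π : Interp L S B) {f : A → B}
    (hf : f.Injective) {n : ℕ} {φ : NNF L n} (hφ : φ.IsSigma1) (a : Fin n → A) :
    (π.comap f).eval φ a ≤ π.eval φ (f ∘ a) := by
  induction hφ with
  | of_quantifierFree h => exact (eval_comap_of_quantifierFree π hf h a).le
  | ex h ih =>
    refine sum_le fun b _ => (ih _).trans ?_
    rw [← snoc_comp]
    exact le_sum (fun b => π.eval _ (Fin.snoc (f ∘ a) b)) (Finset.mem_univ (f b))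

/-- Values at least `c` do not depend on the literals of value below `c`. -/
theorem eval_le_eval_of_le [Fintype A] {π π' : Interp L S A} {c : S} (hc : c ≠ 0)
    (hpos : ∀ (k : ℕ) (R : L.Relations k) a, c ≤ π.pos R a → π.pos R a ≤ π'.pos R a)
    (hneg : ∀ (k : ℕ) (R : L.Relations k) a, c ≤ π.neg R a → π.neg R a ≤ π'.neg R a)
    {n : ℕ} (φ : NNF L n) (a : Fin n → A) (h : c ≤ π.eval φ a) :
    π.eval φ a ≤ π'.eval φ a := by
  induction φ with
  | top => simp [eval]
  | bot => simp [eval]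
  | eq i j => simp [eval]
  | ne i j => simp [eval]
  | rel R x => exact hpos _ R _ h
  | nrel R x => exact hneg _ R _ h
  | or φ θ h1 h2 =>
    simp only [eval, add_eq_max] at h ⊢
    rcases le_total (π.eval φ a) (π.eval θ a) with h' | h'
    · rw [max_eq_right h'] at h ⊢
      exact le_max_of_le_right (h2 a h)
    · rw [max_eq_left h'] at h ⊢
      exact le_max_of_le_left (h1 a h)
  | and φ θ h1 h2 =>
    exact mul_le_mul' (h1 a (h.trans (mul_le_left _ _))) (h2 a (h.trans (mul_le_right _ _)))
  | ex φ ih =>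
    obtain ⟨b, hb, hle⟩ := exists_mem_le_of_le_sum hc h
    exact hle.trans ((ih _ (h.trans hle)).trans
      (le_sum (fun b => π'.eval φ (Fin.snoc a b)) hb))
  | all φ ih =>
    exact Finset.prod_le_prod' fun b hb =>
      ih _ (h.trans (prod_le (fun b => π.eval φ (Fin.snoc a b)) hb))

theorem eval_mono [Fintype A] {π π' : Interp L S A}
    (hpos : ∀ (k : ℕ) (R : L.Relations k) a, π.pos R a ≤ π'.pos R a)
    (hneg : ∀ (k : ℕ) (R : L.Relations k) a, π.neg R a ≤ π'.neg R a)
    {n : ℕ} (φ : NNF L n) (a : Fin n → A) : π.eval φ a ≤ π'.eval φ a := by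
  by_cases h : π.eval φ a = 0
  · exact h ▸ zero_le_self _
  -- The value itself serves as the threshold.
  · exact eval_le_eval_of_le h (fun k R a _ => hpos k R a) (fun k R a _ => hneg k R a) φ a le_rfl

/-- Every value is `1` or bounded by a common bound of the literals. -/
theorem eval_eq_one_or_le [Fintype A] {π : Interp L S A} {v : S}
    (hpos : ∀ (k : ℕ) (R : L.Relations k) a, π.pos R a ≤ v)
    (hneg : ∀ (k : ℕ) (R : L.Relations k) a, π.neg R a ≤ v)
    {n : ℕ} (φ : NNF L n) (a : Fin n → A) : π.eval φ a = 1 ∨ π.eval φ a ≤ v := by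
  induction φ with
  | top => simp [eval]
  | bot => exact .inr (zero_le_self _)
  | eq i j => simp only [eval]; split_ifs <;> simp [zero_le_self]
  | ne i j => simp only [eval]; split_ifs <;> simp [zero_le_self]
  | rel R x => exact .inr (hpos _ R _)
  | nrel R x => exact .inr (hneg _ R _)
  | or φ θ h1 h2 =>
    simp only [eval, add_eq_max]
    rcases le_total (π.eval φ a) (π.eval θ a) with h' | h'
    · rw [max_eq_right h']; exact h2 a
    · rw [max_eq_left h']; exact h1 a
  | and φ θ h1 h2 =>
    simp only [eval]
    rcases h1 a with h | h
    · rw [h, one_mul]; exact h2 a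
    · exact .inr ((mul_le_left _ _).trans h)
  | ex φ ih =>
    by_cases h : ∃ b, π.eval φ (Fin.snoc a b) = 1
    · obtain ⟨b, hb⟩ := h
      refine .inl (le_antisymm (le_one' _) ?_)
      rw [← hb]
      exact le_sum (fun b => π.eval φ (Fin.snoc a b)) (Finset.mem_univ b)
    · push Not at h
      exact .inr (sum_le fun b _ => (ih _).resolve_left (h b))
  | all φ ih =>
    by_cases h : ∀ b, π.eval φ (Fin.snoc a b) = 1
    · exact .inl (Finset.prod_eq_one fun b _ => h b)
    · push Not at h
      obtain ⟨b, hb⟩ := h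
      exact .inr ((prod_le (fun b => π.eval φ (Fin.snoc a b)) (Finset.mem_univ b)).trans
        ((ih _).resolve_left hb))

/-- The literals of value above `v` are lowered to `v`. -/
def cap (π : Interp L S A) (v : S) : Interp L S A where
  pos R a := min (π.pos R a) v
  neg R a := min (π.neg R a) v

theorem min_eq_zero_iff {s v : S} (hv : v ≠ 0) : min s v = 0 ↔ s = 0 := by
  constructor
  · intro h
    rcases min_choice s v with h' | h'
    · rw [← h', h]
    · exact absurd (h'.symm.trans h) hv
  · rintro rfl
    exact min_eq_left (zero_le_self _)

theorem cap_modelDefining {π : Interp L S A} (h : π.ModelDefining) {v : S} (hv : v ≠ 0) :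
    (π.cap v).ModelDefining := fun k R a => by
  simpa only [cap, min_eq_zero_iff hv] using h k R a

/-- Capping the literals at `v` costs at most a power of `v` that does not depend on `v`. -/
theorem exists_pow_mul_eval_le_cap [Fintype A] (π : Interp L S A) {n : ℕ} (φ : NNF L n) :
    ∃ m : ℕ, ∀ (v : S) (a : Fin n → A), v ^ m * π.eval φ a ≤ (π.cap v).eval φ a := by
  induction φ with
  | top => exact ⟨0, fun v a => by simp [eval]⟩
  | bot => exact ⟨0, fun v a => by simp [eval]⟩
  | eq i j => exact ⟨0, fun v a => by simp [eval]⟩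
  | ne i j => exact ⟨0, fun v a => by simp [eval]⟩
  | rel R x => exact ⟨1, fun v a => by
      rw [pow_one]; exact le_min (mul_le_right _ _) (mul_le_left _ _)⟩
  | nrel R x => exact ⟨1, fun v a => by
      rw [pow_one]; exact le_min (mul_le_right _ _) (mul_le_left _ _)⟩
  | or φ θ h1 h2 =>
    obtain ⟨m1, h1⟩ := h1
    obtain ⟨m2, h2⟩ := h2
    refine ⟨m1 + m2, fun v a => ?_⟩
    simp only [eval]
    rw [mul_add, add_eq_max (v ^ _ * _), add_eq_max (eval _ _ _)]
    refine max_le_max (le_trans ?_ (h1 v a)) (le_trans ?_ (h2 v a)) <;>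
      refine mul_le_mul' ?_ le_rfl <;> rw [pow_add]
    · exact mul_le_left _ _
    · exact mul_le_right _ _
  | and φ θ h1 h2 =>
    obtain ⟨m1, h1⟩ := h1
    obtain ⟨m2, h2⟩ := h2
    refine ⟨m1 + m2, fun v a => ?_⟩
    simp only [eval]
    rw [pow_add, mul_mul_mul_comm]
    exact mul_le_mul' (h1 v a) (h2 v a)
  | ex φ ih =>
    obtain ⟨m, h⟩ := ih
    refine ⟨m, fun v a => ?_⟩
    simp only [eval]
    rw [Finset.mul_sum]
    exact sum_le fun b hb => (h v _).trans
      (le_sum (fun b => (π.cap v).eval φ (Fin.snoc a b)) hb)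
  | all φ ih =>
    obtain ⟨m, h⟩ := ih
    -- Each of the `|A|` factors loses `v ^ m`. The exponent may depend on the universe, only not on
    -- `v`.
    refine ⟨m * Fintype.card A, fun v a => ?_⟩
    simp only [eval]
    rw [pow_mul, ← Finset.card_univ, ← Finset.prod_const, ← Finset.prod_mul_distrib]
    exact Finset.prod_le_prod' fun b _ => h v _

end Interp

/-! ### Bounded witness sets when all literals stay below `1` -/

/-- A bound on the number of elements that witness the value of a formula without essential
universal quantifiers. -/
def NNF.witnessBound {L : FirstOrder.Language} : {n : ℕ} → NNF L n → ℕ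
  | _, .top => 0
  | _, .bot => 0
  | _, .eq _ _ => 0
  | _, .ne _ _ => 0
  | _, .rel (k := k) _ _ => k
  | _, .nrel (k := k) _ _ => k
  | _, .or φ θ => φ.witnessBound + θ.witnessBound
  | _, .and φ θ => φ.witnessBound + θ.witnessBound
  | _, .ex φ => φ.witnessBound + 1
  | n, .all φ => n * φ.witnessBound + φ.witnessBound + n + 1

/-- The image of `s` is enlarged to a set with exactly as many elements as `t`, and the partial
injection extends to a bijection onto it. This places witnesses injectively in another universe
while keeping prescribed images. -/
theorem Finset.exists_injOn_extension {α β : Type*} [DecidableEq α] [Fintype β]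
    {f : α → β} {s t : Finset α} (hf : Set.InjOn f s) (hst : s ⊆ t) (ht : t.card ≤ Fintype.card β) :
    ∃ g : α → β, Set.InjOn g t ∧ ∀ a ∈ s, g a = f a := by
  classical
  obtain ⟨r, hr, hr'⟩ := Finset.exists_subsuperset_card_eq (Finset.subset_univ (s.image f))
    ((Finset.card_image_le).trans (Finset.card_le_card hst)) (by simpa using ht)
  obtain ⟨e, he⟩ := Finset.exists_equiv_extend_of_card_eq (α := t) (t := r)
    (s := s.subtype (· ∈ t)) (f := fun a => f a) (by simp [hr'])
    (fun y hy => by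
      obtain ⟨x, hx, rfl⟩ := Finset.mem_image.1 hy
      exact hr (Finset.mem_image_of_mem f (Finset.mem_subtype.1 hx)))
    (fun x hx y hy h => Subtype.ext (hf (Finset.mem_subtype.1 hx) (Finset.mem_subtype.1 hy) h))
  refine ⟨fun a => if h : a ∈ t then e ⟨a, h⟩ else f a, fun x hx y hy h => ?_, fun a ha => ?_⟩
  · rw [Finset.mem_coe] at hx hy
    simpa [hx, hy, Subtype.ext_iff] using h
  · simpa [hst ha] using he ⟨a, hst ha⟩ (Finset.mem_subtype.2 ha)

namespace Interp

open MaxSemiring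

variable {L : FirstOrder.Language.{u, v}} {S : Type*} [CommSemiring S] [LinearOrder S]
  [MaxSemiring S]

/-- If all literals are at most `v < 1`, a value that is large compared to a power of `v` with
exponent about the size of the universe is witnessed by few elements, and persists under all maps
that are injective on these and do not decrease the literals over them. -/
theorem exists_witness_finset {n : ℕ} (φ : NNF L n) :
    ∀ {U : Type w} [Fintype U] (π : Interp L S U) {v c : S} (_ : v < 1)
      (_ : ∀ (k : ℕ) (R : L.Relations k) a, π.pos R a ≤ v)
      (_ : ∀ (k : ℕ) (R : L.Relations k) a, π.neg R a ≤ v)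
      (_ : v ^ (Fintype.card U - φ.witnessBound) < c)
      (b : Fin n → U) (_ : c ≤ π.eval φ b),
      ∃ C : Finset U, C.card ≤ φ.witnessBound ∧
        ∀ {U' : Type w} [Fintype U'] (π' : Interp L S U') (g : U → U'),
          φ.witnessBound ≤ Fintype.card U' →
          Set.InjOn g (C ∪ Set.range b) →
          (∀ (k : ℕ) (R : L.Relations k) a, (∀ i, a i ∈ C) →
            π.pos R a ≤ π'.pos R (g ∘ a) ∧ π.neg R a ≤ π'.neg R (g ∘ a)) →
          π.eval φ b ≤ π'.eval φ (g ∘ b) := by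
  induction φ with
  | top =>
    intro U _ π v c _ _ _ _ b _
    exact ⟨∅, by simp, fun π' g _ _ _ => by simp [eval]⟩
  | bot =>
    intro U _ π v c _ _ _ _ b _
    exact ⟨∅, by simp, fun π' g _ _ _ => by simp [eval]⟩
  | eq i j =>
    intro U _ π v c _ _ _ _ b _
    refine ⟨∅, by simp, fun π' g _ hg _ => ?_⟩
    refine le_of_eq ?_
    classical exact if_congr (hg.eq_iff (x := b i) (y := b j) (by simp) (by simp)).symm rfl rfl
  | ne i j =>
    intro U _ π v c _ _ _ _ b _
    refine ⟨∅, by simp, fun π' g _ hg _ => ?_⟩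
    refine le_of_eq ?_
    classical exact if_congr (hg.eq_iff (x := b i) (y := b j) (by simp) (by simp)).symm rfl rfl
  | rel R x =>
    intro U _ π v c _ _ _ _ b _
    classical
    refine ⟨Finset.univ.image (b ∘ x), Finset.card_image_le.trans (by simp [NNF.witnessBound]),
      fun π' g _ _ h => ?_⟩
    exact (h _ R (b ∘ x) (by simp)).1
  | nrel R x =>
    intro U _ π v c _ _ _ _ b _
    classical
    refine ⟨Finset.univ.image (b ∘ x), Finset.card_image_le.trans (by simp [NNF.witnessBound]),
      fun π' g _ _ h => ?_⟩
    exact (h _ R (b ∘ x) (by simp)).2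
  | or φ θ h1 h2 =>
    intro U _ π v c hv hp hn hc b h
    simp only [NNF.witnessBound] at hc ⊢
    simp only [eval, add_eq_max] at h ⊢
    rcases le_total (π.eval φ b) (π.eval θ b) with h' | h'
    · rw [max_eq_right h'] at h ⊢
      obtain ⟨C, hC, H⟩ := h2 π hv hp hn
        ((pow_le_pow_right_of_le_one' hv.le (by omega)).trans_lt hc) b h
      exact ⟨C, by omega, fun π' g hg hg' hl => le_max_of_le_right (H π' g (by omega) hg' hl)⟩
    · rw [max_eq_left h'] at h ⊢
      obtain ⟨C, hC, H⟩ := h1 π hv hp hn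
        ((pow_le_pow_right_of_le_one' hv.le (by omega)).trans_lt hc) b h
      exact ⟨C, by omega, fun π' g hg hg' hl => le_max_of_le_left (H π' g (by omega) hg' hl)⟩
  | and φ θ h1 h2 =>
    intro U _ π v c hv hp hn hc b h
    classical
    simp only [NNF.witnessBound] at hc ⊢
    simp only [eval] at h ⊢
    obtain ⟨C1, hC1, H1⟩ := h1 π hv hp hn
      ((pow_le_pow_right_of_le_one' hv.le (by omega)).trans_lt hc) b (h.trans (mul_le_left _ _))
    obtain ⟨C2, hC2, H2⟩ := h2 π hv hp hn
      ((pow_le_pow_right_of_le_one' hv.le (by omega)).trans_lt hc) b (h.trans (mul_le_right _ _))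
    refine ⟨C1 ∪ C2, (Finset.card_union_le _ _).trans (by omega), fun π' g hg hg' hl =>
      mul_le_mul' (H1 π' g (by omega) (hg'.mono ?_) fun k R a ha => hl k R a fun i => ?_)
        (H2 π' g (by omega) (hg'.mono ?_) fun k R a ha => hl k R a fun i => ?_)⟩
    · exact Set.union_subset_union_left _ (Finset.coe_subset.2 Finset.subset_union_left)
    · exact Finset.mem_union_left _ (ha i)
    · exact Set.union_subset_union_left _ (Finset.coe_subset.2 Finset.subset_union_right)
    · exact Finset.mem_union_right _ (ha i)
  | ex φ ih =>
    intro U _ π v c hv hp hn hc b h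
    classical
    simp only [NNF.witnessBound] at hc ⊢
    obtain ⟨d, hd, hle⟩ := exists_mem_le_of_le_sum ((zero_le_self _).trans_lt hc).ne' h
    obtain ⟨C, hC, H⟩ := ih π hv hp hn
      ((pow_le_pow_right_of_le_one' hv.le (by omega)).trans_lt hc) (Fin.snoc b d) (h.trans hle)
    refine ⟨insert d C, (Finset.card_insert_le _ _).trans (by omega), fun π' g hg hg' hl => ?_⟩
    refine hle.trans ((H π' g (by omega) (hg'.mono ?_) fun k R a ha => hl k R a fun i =>
      Finset.mem_insert_of_mem (ha i)).trans ?_)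
    · intro x
      simp only [Finset.coe_insert, Fin.range_snoc, Set.mem_union, Set.mem_insert_iff]
      tauto
    · rw [← snoc_comp]
      exact le_sum (fun b' => π'.eval φ (Fin.snoc (g ∘ b) b')) (Finset.mem_univ (g d))
  | @all n φ ih =>
    intro U _ π v c hv hp hn hc b h
    classical
    simp only [NNF.witnessBound] at hc ⊢
    have hc' : v ^ (Fintype.card U - φ.witnessBound) < c :=
      (pow_le_pow_right_of_le_one' hv.le (by omega)).trans_lt hc
    have hfac : ∀ a, c ≤ π.eval φ (Fin.snoc b a) := fun a =>
      h.trans (prod_le (fun a => π.eval φ (Fin.snoc b a)) (Finset.mem_univ a))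
    choose! C hC H using fun i : Fin n => ih π hv hp hn hc' (Fin.snoc b (b i)) (hfac _)
    have hB : (Finset.univ.image b).card ≤ n := Finset.card_image_le.trans (by simp)
    -- Otherwise all of the at least `|U| - n` factors outside the parameters are at most `v`, which
    -- makes the product too small.
    obtain ⟨d, hdb, hd⟩ : ∃ d, d ∉ Finset.univ.image b ∧ π.eval φ (Fin.snoc b d) = 1 := by
      by_contra! hcon
      refine absurd hc (not_lt.2 (h.trans ?_))
      refine (prod_le_prod_of_subset (fun a => π.eval φ (Fin.snoc b a))
        (Finset.subset_univ (Finset.univ.image b)ᶜ)).trans ?_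
      refine (Finset.prod_le_pow_card _ _ v fun a ha => ?_).trans
        (pow_le_pow_right_of_le_one' hv.le ?_)
      · exact (eval_eq_one_or_le hp hn φ _).resolve_left (hcon a (Finset.mem_compl.1 ha))
      · rw [Finset.card_compl]
        omega
    -- No literal reaches the threshold `1`, so a value `1` survives when all literals are set to
    -- `0`. It can therefore be transferred to any interpretation.
    have hd0 : 1 ≤ (zero : Interp L S U).eval φ (Fin.snoc b d) := by
      refine hd.ge.trans (eval_le_eval_of_le (π := π) (c := 1) ((zero_le_self v).trans_lt hv).ne' ?_ ?_ φ _ hd.ge)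
      · exact fun k R a ha => absurd (ha.trans (hp k R a)) (not_le.2 hv)
      · exact fun k R a ha => absurd (ha.trans (hn k R a)) (not_le.2 hv)
    obtain ⟨C0, hC0, H0⟩ := ih (zero : Interp L S U) (v := v) (c := 1) hv
      (fun _ _ _ => zero_le_self _) (fun _ _ _ => zero_le_self _)
      (hc'.trans_le (h.trans (le_one' _))) _ hd0
    refine ⟨Finset.univ.biUnion C, ?_, fun {U'} _ π' g hg hg' hl => ?_⟩
    · refine (Finset.card_biUnion_le_card_mul _ _ _ fun i _ => hC i).trans ?_
      simp only [Finset.card_univ, Fintype.card_fin]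
      omega
    have hgb : Set.InjOn g (Finset.univ.image b : Finset U) :=
      hg'.mono (by simp)
    -- The element `d` is sent to the given fresh `a'` and the parameters are moved by `g`; the
    -- witnesses `C0` for the value at `d` fit injectively around them because `U'` is large enough.
    have hfresh : ∀ a' ∉ (Finset.univ.image b).image g, π'.eval φ (Fin.snoc (g ∘ b) a') = 1 := by
      intro a' ha'
      have hgd : Set.InjOn (Function.update g d a')
          (insert d (Finset.univ.image b) : Finset U) := by
        have hne : ∀ x ∈ Finset.univ.image b, Function.update g d a' x = g x := fun x hx =>
          Function.update_of_ne (ne_of_mem_of_not_mem hx hdb) _ _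
        rw [Finset.coe_insert, Set.injOn_insert (by simpa using hdb)]
        refine ⟨hgb.congr fun x hx => (hne x hx).symm, ?_⟩
        rintro ⟨x, hx, hxd⟩
        rw [hne x hx, Function.update_self] at hxd
        exact ha' (Finset.mem_image.2 ⟨x, hx, hxd⟩)
      obtain ⟨g', hg'inj, hg'eq⟩ := Finset.exists_injOn_extension hgd
        (t := C0 ∪ insert d (Finset.univ.image b)) Finset.subset_union_right
        ((Finset.card_union_le _ _).trans (by
          have := Finset.card_insert_le d (Finset.univ.image b)
          omega))
      refine le_antisymm (le_one' _) (hd0.trans ((H0 π' g' (by omega) ?_ ?_).trans_eq ?_))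
      · refine hg'inj.mono fun x => ?_
        simp only [Finset.coe_union, Finset.coe_image, Finset.coe_univ, Set.image_univ,
          Finset.coe_insert, Fin.range_snoc, Set.mem_union, Set.mem_insert_iff]
        tauto
      · exact fun k R a _ => ⟨zero_le_self _, zero_le_self _⟩
      · rw [← snoc_comp]
        congr 2
        · funext i
          have hbi : b i ∈ Finset.univ.image b := by simp
          rw [Function.comp_apply, hg'eq _ (Finset.mem_insert_of_mem hbi),
            Function.update_of_ne (ne_of_mem_of_not_mem hbi hdb)]
          rfl
        · rw [hg'eq d (Finset.mem_insert_self _ _), Function.update_self]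
    calc π.eval (.all φ) b
        ≤ ∏ a ∈ Finset.univ.image b, π.eval φ (Fin.snoc b a) :=
          prod_le_prod_of_subset _ (Finset.subset_univ _)
      _ ≤ ∏ a ∈ Finset.univ.image b, π'.eval φ (Fin.snoc (g ∘ b) (g a)) := by
          refine Finset.prod_le_prod' fun a ha => ?_
          obtain ⟨i, -, rfl⟩ := Finset.mem_image.1 ha
          rw [snoc_comp]
          refine H i π' g (by omega) (hg'.mono fun x => ?_) fun k R a ha => hl k R a fun j =>
            Finset.mem_biUnion.2 ⟨i, Finset.mem_univ _, ha j⟩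
          simp only [Finset.coe_univ, Fin.range_snoc, Set.mem_union, Set.mem_insert_iff, Finset.coe_biUnion,
            Set.mem_iUnion, Finset.mem_coe]
          rintro (hx | rfl | hx)
          · exact .inl ⟨i, trivial, hx⟩
          · exact .inr ⟨i, rfl⟩
          · exact .inr hx
      _ = ∏ a' ∈ (Finset.univ.image b).image g, π'.eval φ (Fin.snoc (g ∘ b) a') :=
          (Finset.prod_image (f := fun a' => π'.eval φ (Fin.snoc (g ∘ b) a')) hgb).symm
      -- Only factors equal to `1` are added.
      _ = π'.eval (.all φ) (g ∘ b) :=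
          Finset.prod_subset (Finset.subset_univ _) fun a' _ ha' => hfresh a' ha'

end Interp

/-! ### Small subinterpretations attaining the value -/

namespace Interp

open MaxSemiring

variable {L : FirstOrder.Language.{u, v}} {S : Type s}

/-- The induced interpretation is isomorphic to the subinterpretation on the image of `f`, which
turns preservation from inclusions to embeddings. -/
theorem value_comap_le_of_finExtPreserved [CommSemiring S] [LinearOrder S] [MaxSemiring S]
    {ψ : NNF L 0}
    (hψ : FinExtPreserved.{w} S ψ)
    {A B : Type w} [Fintype A] [Nonempty A] [Fintype B] {π : Interp L S B} (hπ : π.ModelDefining)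
    {f : A → B} (hf : f.Injective) : (π.comap f).value ψ ≤ π.value ψ := by
  classical
  let R : Finset B := Finset.univ.map ⟨f, hf⟩
  let e : A ≃ R := Equiv.ofBijective (fun a => ⟨f a, by simp [R]⟩)
    ⟨fun a b h => hf (congrArg Subtype.val h), by
      rintro ⟨b, hb⟩
      obtain ⟨a, -, rfl⟩ := Finset.mem_map.1 hb
      exact ⟨a, rfl⟩⟩
  have h := hψ B R (π.comap (↑)) π (Finset.map_nonempty.2 Finset.univ_nonempty)
    (comap_modelDefining hπ _) hπ (comap_isSubinterpretation π R)
  rw [natLE_iff, ← value_comap_equiv _ e] at h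
  exact h

/-- The interpretation on `B ⊕ D` that has value `p` on the positive and `q` on the negative
literals involving elements of `D`. -/
noncomputable def sumConst {B D : Type*} (π : Interp L S B) (p q : S) : Interp L S (B ⊕ D) where
  pos R a := open Classical in
    if h : ∃ b, a = Sum.inl ∘ b then π.pos R h.choose else p
  neg R a := open Classical in
    if h : ∃ b, a = Sum.inl ∘ b then π.neg R h.choose else q

section sumConst

variable {B D : Type*} (π : Interp L S B) (p q : S)

theorem sumConst_inl {k : ℕ} (R : L.Relations k) (b : Fin k → B) :
    (π.sumConst p q (D := D)).pos R (Sum.inl ∘ b) = π.pos R b ∧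
      (π.sumConst p q (D := D)).neg R (Sum.inl ∘ b) = π.neg R b := by
  have h : ∃ b', (Sum.inl ∘ b : Fin k → B ⊕ D) = Sum.inl ∘ b' := ⟨b, rfl⟩
  have h' : h.choose = b := (Sum.inl_injective.comp_left h.choose_spec).symm
  simp only [sumConst, dif_pos h, h', and_self]

theorem sumConst_of_not {k : ℕ} (R : L.Relations k) {a : Fin k → B ⊕ D}
    (h : ¬ ∃ b, a = Sum.inl ∘ b) :
    (π.sumConst p q).pos R a = p ∧ (π.sumConst p q).neg R a = q := by
  simp only [sumConst, dif_neg h, and_self]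

theorem comap_inl_sumConst : (π.sumConst p q (D := D)).comap Sum.inl = π := by
  cases π
  simp only [comap, Interp.mk.injEq]
  exact ⟨by funext k R b; exact (sumConst_inl _ p q R b).1,
    by funext k R b; exact (sumConst_inl _ p q R b).2⟩

theorem sumConst_modelDefining [CommSemiring S] {π : Interp L S B} (hπ : π.ModelDefining) {q : S} (hq : q ≠ 0) :
    (π.sumConst 0 q (D := D)).ModelDefining := fun k R a => by
  by_cases h : ∃ b, a = Sum.inl ∘ b
  · obtain ⟨b, rfl⟩ := h
    rw [(sumConst_inl π 0 q R b).1, (sumConst_inl π 0 q R b).2]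
    exact hπ k R b
  · rw [(sumConst_of_not π 0 q R h).1, (sumConst_of_not π 0 q R h).2]
    exact .inl ⟨rfl, hq⟩

end sumConst

variable [CommSemiring S] [LinearOrder S] [MaxSemiring S]

/-- Padding makes the universe large enough for `exists_witness_finset`; the resulting witnesses are
then moved into a `K`-element subset of `B`, fixing those that already lie in `B`. -/
theorem exists_small_le_of_lt_one {ψ : NNF L 0} (hψ : FinExtPreserved.{w} S ψ)
    {B : Type w} [Fintype B] [Nonempty B] {π : Interp L S B} (hπ : π.ModelDefining) {v : S}
    (hv : v < 1) (hpos : ∀ (k : ℕ) (R : L.Relations k) a, π.pos R a ≤ v)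
    (hneg : ∀ (k : ℕ) (R : L.Relations k) a, π.neg R a ≤ v) {K : ℕ} (hK : ψ.witnessBound ≤ K) (hK0 : 0 < K)
    (hKB : K ≤ Fintype.card B) (h0 : π.value ψ ≠ 0) :
    ∃ A : Finset B, A.card = K ∧ π.value ψ ≤ (π.comap ((↑) : A → B)).value ψ := by
  classical
  -- The value of the negative literals on the dummy elements: nonzero, to stay model-defining, but
  -- too small to influence the value of `ψ`.
  obtain ⟨q, hq0, hq⟩ := exists_pos_lt _ h0
  obtain ⟨n, hn⟩ := exists_pow_lt v _ hv h0
  -- The summand `n` beats the power of `v`; `ψ.witnessBound` compensates for the subtraction in the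
  -- exponent.
  let D : Type w := ULift (Fin (n + ψ.witnessBound))
  let U := B ⊕ D
  have hU : v ^ (Fintype.card U - ψ.witnessBound) < π.value ψ := by
    refine (pow_le_pow_right_of_le_one' hv.le ?_).trans_lt hn
    simp only [U, D, Fintype.card_sum, Fintype.card_ulift, Fintype.card_fin]
    omega
  have h1 : π.value ψ ≤ (π.sumConst 0 q : Interp L S U).value ψ := by
    have := value_comap_le_of_finExtPreserved hψ (sumConst_modelDefining (D := D) hπ hq0)
      Sum.inl_injective
    rwa [comap_inl_sumConst] at this
  -- Erasing `q` leaves the model-defining interpretations, but now literals involving dummies are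
  -- dominated by any others, so dummies can be moved freely.
  have h2 : π.value ψ ≤ (π.sumConst 0 0 : Interp L S U).value ψ := by
    refine h1.trans (eval_le_eval_of_le h0 (fun k R a ha => ?_) (fun k R a ha => ?_) ψ _ h1)
    · by_cases h : ∃ b, a = Sum.inl ∘ b
      · obtain ⟨b, rfl⟩ := h
        rw [(sumConst_inl π _ _ R b).1, (sumConst_inl π _ _ R b).1]
      · rw [(sumConst_of_not π _ _ R h).1, (sumConst_of_not π _ _ R h).1]
    · by_cases h : ∃ b, a = Sum.inl ∘ b
      · obtain ⟨b, rfl⟩ := h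
        rw [(sumConst_inl π _ _ R b).2, (sumConst_inl π _ _ R b).2]
      · rw [(sumConst_of_not π _ _ R h).2] at ha
        exact absurd ha (not_le.2 hq)
  obtain ⟨C, hC, H⟩ := exists_witness_finset ψ (π.sumConst 0 0 : Interp L S U) hv
    (fun k R a => by
      by_cases h : ∃ b, a = Sum.inl ∘ b
      · obtain ⟨b, rfl⟩ := h
        rw [(sumConst_inl π _ _ R b).1]
        exact hpos k R b
      · rw [(sumConst_of_not π _ _ R h).1]
        exact zero_le_self _)
    (fun k R a => by
      by_cases h : ∃ b, a = Sum.inl ∘ b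
      · obtain ⟨b, rfl⟩ := h
        rw [(sumConst_inl π _ _ R b).2]
        exact hneg k R b
      · rw [(sumConst_of_not π _ _ R h).2]
        exact zero_le_self _) hU _ h2
  let CB : Finset B := Finset.univ.filter fun b => Sum.inl b ∈ C
  have hCB : CB.map .inl ⊆ C := fun x hx => by
    obtain ⟨b, hb, rfl⟩ := Finset.mem_map.1 hx
    exact (Finset.mem_filter.1 hb).2
  have hCBcard : CB.card ≤ K := by
    have := Finset.card_le_card hCB
    rw [Finset.card_map] at this
    omega
  obtain ⟨A, hA, hAcard⟩ := Finset.exists_superset_card_eq hCBcard hKB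
  refine ⟨A, hAcard, h2.trans ?_⟩
  -- Witnesses in `B` stay in place, and dummy witnesses go to unused elements of `A`; there is room
  -- because `C` has at most `K` elements.
  obtain ⟨f, hf, hfb⟩ : ∃ f : U → A, Set.InjOn f C ∧ ∀ b (hb : b ∈ CB),
      f (.inl b) = ⟨b, hA hb⟩ := by
    obtain ⟨a0, ha0⟩ : A.Nonempty := Finset.card_pos.1 (by omega)
    let f0 : U → A := Sum.elim (fun b => if h : b ∈ A then ⟨b, h⟩ else ⟨a0, ha0⟩) fun _ => ⟨a0, ha0⟩
    have hf0 : ∀ b (hb : b ∈ CB), f0 (.inl b) = ⟨b, hA hb⟩ := fun b hb => by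
      simp [f0, hA hb]
    obtain ⟨f, hf, hff⟩ := Finset.exists_injOn_extension (f := f0) (s := CB.map .inl) (t := C)
      (fun x hx y hy h => by
        obtain ⟨x, hx', rfl⟩ := Finset.mem_map.1 (Finset.mem_coe.1 hx)
        obtain ⟨y, hy', rfl⟩ := Finset.mem_map.1 (Finset.mem_coe.1 hy)
        change f0 (.inl x) = f0 (.inl y) at h
        rw [hf0 x hx', hf0 y hy'] at h
        exact congrArg Sum.inl (congrArg Subtype.val h :))
      hCB (by rw [Fintype.card_coe]; omega)
    exact ⟨f, hf, fun b hb => (hff _ (Finset.mem_map_of_mem _ hb)).trans (hf0 b hb)⟩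
  refine (H (π.comap ((↑) : A → B)) f ?_ ?_ ?_).trans_eq ?_
  · rw [Fintype.card_coe]; omega
  · rw [Set.range_eq_empty, Set.union_empty]; exact hf
  · intro k R a ha
    by_cases h : ∃ b, a = Sum.inl ∘ b
    · obtain ⟨b, rfl⟩ := h
      have hb : ∀ i, b i ∈ CB := fun i => Finset.mem_filter.2 ⟨Finset.mem_univ _, ha i⟩
      have : (fun x : A => (x : B)) ∘ f ∘ Sum.inl ∘ b = b := by
        funext i
        exact congrArg Subtype.val (hfb (b i) (hb i))
      rw [(sumConst_inl π _ _ R b).1, (sumConst_inl π _ _ R b).2]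
      simp only [comap]
      rw [this]
      exact ⟨le_rfl, le_rfl⟩
    · rw [(sumConst_of_not π _ _ R h).1, (sumConst_of_not π _ _ R h).2]
      exact ⟨zero_le_self _, zero_le_self _⟩
  · rw [value]
    congr 1
    exact Subsingleton.elim _ _

/-- A sentence that is preserved under extensions attains its value in a substructure of bounded
size. -/
theorem exists_small_le {ψ : NNF L 0} (hψ : FinExtPreserved.{w} S ψ)
    {B : Type w} [Fintype B] [Nonempty B] {π : Interp L S B} (hπ : π.ModelDefining) :
    ∃ A : Finset B, A.Nonempty ∧ A.card ≤ ψ.witnessBound + 1 ∧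
      π.value ψ ≤ (π.comap ((↑) : A → B)).value ψ := by
  classical
  rcases le_or_gt (Fintype.card B) (ψ.witnessBound + 1) with hB | hB
  · refine ⟨Finset.univ, Finset.univ_nonempty, hB, ?_⟩
    exact (value_comap_equiv π (Equiv.subtypeUnivEquiv Finset.mem_univ) ψ).ge
  -- The best small subset is fixed before `v`, so that `v` can be adapted to the supposed gap.
  obtain ⟨A, hA, hmax⟩ := (Finset.univ.filter fun A : Finset B =>
    A.Nonempty ∧ A.card ≤ ψ.witnessBound + 1).exists_max_image
      (fun A => (π.comap ((↑) : A → B)).value ψ)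
      ⟨{Classical.arbitrary B}, by simp⟩
  simp only [Finset.mem_filter, Finset.mem_univ, true_and, and_imp] at hA hmax
  refine ⟨A, hA.1, hA.2, ?_⟩
  by_contra! hlt
  obtain ⟨m, hm⟩ := exists_pow_mul_eval_le_cap π ψ
  -- The exponent `m` would suffice for the estimate; the extra factor forces `v ≠ 0`, so that
  -- capping creates no new zeros.
  obtain ⟨v, hv, hdv⟩ := exists_lt_pow_mul hlt (m + 1)
  have hv0 : v ≠ 0 := by
    rintro rfl
    rw [pow_succ, mul_zero, zero_mul] at hdv
    exact not_lt.2 (zero_le_self _) hdv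
  have hcap : (π.comap ((↑) : A → B)).value ψ < (π.cap v).value ψ := by
    refine hdv.trans_le (le_trans ?_ (hm v _))
    exact mul_le_mul' (pow_le_pow_right_of_le_one' hv.le (Nat.le_succ m)) le_rfl
  obtain ⟨A', hA', hle⟩ := exists_small_le_of_lt_one hψ (cap_modelDefining hπ hv0) hv
    (fun k R a => min_le_right _ _) (fun k R a => min_le_right _ _) (Nat.le_succ ψ.witnessBound)
    (Nat.succ_pos _) hB.le ((zero_le_self _).trans_lt hcap).ne'
  refine absurd (hcap.trans_le (hle.trans ?_)) (not_lt.2 (hmax A' ?_ hA'.le))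
  · exact eval_mono (fun k R a => min_le_left _ _) (fun k R a => min_le_left _ _) ψ _
  · exact Finset.card_pos.1 (by omega)

end Interp

/-! ### Relativization to finitely many variables -/

namespace NNF

variable {L : FirstOrder.Language.{u, v}}

/-- The disjunction of a list of formulae. -/
def bigOr {n : ℕ} : List (NNF L n) → NNF L n
  | [] => .bot
  | φ :: l => .or φ (bigOr l)

/-- The conjunction of a list of formulae. -/
def bigAnd {n : ℕ} : List (NNF L n) → NNF L n
  | [] => .top
  | φ :: l => .and φ (bigAnd l)

/-- `φ.relativize J σ` is `φ` with the free variables renamed by `σ` and the quantifiers ranging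
over the variables in `J`. -/
noncomputable def relativize {K : ℕ} (J : Finset (Fin K)) : {n : ℕ} → NNF L n → (Fin n → Fin K) →
    NNF L K
  | _, .top, _ => .top
  | _, .bot, _ => .bot
  | _, .eq i j, σ => .eq (σ i) (σ j)
  | _, .ne i j, σ => .ne (σ i) (σ j)
  | _, .rel R x, σ => .rel R (σ ∘ x)
  | _, .nrel R x, σ => .nrel R (σ ∘ x)
  | _, .or φ θ, σ => .or (φ.relativize J σ) (θ.relativize J σ)
  | _, .and φ θ, σ => .and (φ.relativize J σ) (θ.relativize J σ)
  | _, .ex φ, σ => bigOr (J.toList.map fun j => φ.relativize J (Fin.snoc σ j))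
  | _, .all φ, σ => bigAnd (J.toList.map fun j => φ.relativize J (Fin.snoc σ j))

theorem bigOr_quantifierFree {n : ℕ} {l : List (NNF L n)} (h : ∀ φ ∈ l, φ.QuantifierFree) :
    (bigOr l).QuantifierFree := by
  induction l with
  | nil => trivial
  | cons φ l ih => exact ⟨h φ (by simp), ih fun θ hθ => h θ (by simp [hθ])⟩

theorem bigAnd_quantifierFree {n : ℕ} {l : List (NNF L n)} (h : ∀ φ ∈ l, φ.QuantifierFree) :
    (bigAnd l).QuantifierFree := by
  induction l with
  | nil => trivial
  | cons φ l ih => exact ⟨h φ (by simp), ih fun θ hθ => h θ (by simp [hθ])⟩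

theorem relativize_quantifierFree {K : ℕ} (J : Finset (Fin K)) {n : ℕ} (φ : NNF L n)
    (σ : Fin n → Fin K) : (φ.relativize J σ).QuantifierFree := by
  induction φ with
  | or φ θ h1 h2 => exact ⟨h1 σ, h2 σ⟩
  | and φ θ h1 h2 => exact ⟨h1 σ, h2 σ⟩
  | ex φ ih =>
    refine bigOr_quantifierFree fun θ hθ => ?_
    obtain ⟨j, -, rfl⟩ := List.mem_map.1 hθ
    exact ih _
  | all φ ih =>
    refine bigAnd_quantifierFree fun θ hθ => ?_
    obtain ⟨j, -, rfl⟩ := List.mem_map.1 hθ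
    exact ih _
  | _ => trivial

end NNF

namespace Interp

open MaxSemiring

variable {L : FirstOrder.Language.{u, v}} {S : Type s} [CommSemiring S] {B : Type*} [Fintype B]

theorem eval_bigOr (π : Interp L S B) {ι : Type*} {n : ℕ} (J : Finset ι) (f : ι → NNF L n)
    (a : Fin n → B) : π.eval (NNF.bigOr (J.toList.map f)) a = ∑ j ∈ J, π.eval (f j) a := by
  rw [← Finset.sum_map_toList]
  induction J.toList with
  | nil => simp [NNF.bigOr, eval]
  | cons j l ih => simp [NNF.bigOr, eval, ih]

theorem eval_bigAnd (π : Interp L S B) {ι : Type*} {n : ℕ} (J : Finset ι) (f : ι → NNF L n)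
    (a : Fin n → B) : π.eval (NNF.bigAnd (J.toList.map f)) a = ∏ j ∈ J, π.eval (f j) a := by
  rw [← Finset.prod_map_toList]
  induction J.toList with
  | nil => simp [NNF.bigAnd, eval]
  | cons j l ih => simp [NNF.bigAnd, eval, ih]

/-- If the variables in `J` enumerate `A ⊆ B` without repetitions, then relativizing to `J`
amounts to evaluating in `A`. -/
theorem eval_relativize {A : Type*} [Fintype A] (π : Interp L S B) {f : A → B}
    (hf : f.Injective) {K : ℕ} {J : Finset (Fin K)} {y : Fin K → A} (hy : Set.InjOn y J)
    (hy' : ∀ a, ∃ j ∈ J, y j = a) {n : ℕ} (φ : NNF L n) (σ : Fin n → Fin K) :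
    π.eval (φ.relativize J σ) (f ∘ y) = (π.comap f).eval φ (y ∘ σ) := by
  classical
  have hJ : J.image y = Finset.univ := by
    ext a
    simpa using hy' a
  induction φ with
  | top => simp [NNF.relativize, eval]
  | bot => simp [NNF.relativize, eval]
  | eq i j => exact if_congr hf.eq_iff rfl rfl
  | ne i j => exact if_congr hf.eq_iff rfl rfl
  | rel R x => rfl
  | nrel R x => rfl
  | or φ θ h1 h2 => simp [NNF.relativize, eval, h1, h2]
  | and φ θ h1 h2 => simp [NNF.relativize, eval, h1, h2]
  | ex φ ih =>
    simp only [NNF.relativize, eval_bigOr, ih, ← snoc_comp]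
    simp only [eval]
    rw [← hJ, Finset.sum_image hy]
  | all φ ih =>
    simp only [NNF.relativize, eval_bigAnd, ih, ← snoc_comp]
    simp only [eval]
    rw [← hJ, Finset.prod_image hy]

variable [LinearOrder S] [MaxSemiring S]

/-- Repetitions in the enumeration of `A` can only decrease the value. -/
theorem eval_relativize_le {A : Type*} [Fintype A] (π : Interp L S B) {f : A → B}
    (hf : f.Injective) {K : ℕ} {J : Finset (Fin K)} {x : Fin K → B} {y : Fin K → A}
    (hxy : ∀ j ∈ J, f (y j) = x j) (hy' : ∀ a, ∃ j ∈ J, y j = a) {n : ℕ} (φ : NNF L n)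
    (σ : Fin n → Fin K) (hσ : ∀ i, σ i ∈ J) :
    π.eval (φ.relativize J σ) x ≤ (π.comap f).eval φ (y ∘ σ) := by
  have hx : ∀ {n : ℕ} {σ : Fin n → Fin K}, (∀ i, σ i ∈ J) → x ∘ σ = f ∘ y ∘ σ := fun hσ =>
    funext fun i => (hxy _ (hσ i)).symm
  have hsnoc : ∀ {n : ℕ} {σ : Fin n → Fin K}, (∀ i, σ i ∈ J) → ∀ {j}, j ∈ J →
      ∀ i, (Fin.snoc σ j : Fin (n + 1) → Fin K) i ∈ J := fun hσ j hj i => by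
    induction i using Fin.lastCases with
    | last => simpa using hj
    | cast i => simpa using hσ i
  induction φ with
  | top => simp [NNF.relativize, eval]
  | bot => simp [NNF.relativize, eval]
  | eq i j =>
    refine le_of_eq ?_
    classical
    refine if_congr ?_ rfl rfl
    rw [← hxy _ (hσ i), ← hxy _ (hσ j), hf.eq_iff]
    rfl
  | ne i j =>
    refine le_of_eq ?_
    classical
    refine if_congr ?_ rfl rfl
    rw [← hxy _ (hσ i), ← hxy _ (hσ j), hf.eq_iff]
    rfl
  | rel R z => exact (congrArg (π.pos R) (hx fun i => hσ (z i))).le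
  | nrel R z => exact (congrArg (π.neg R) (hx fun i => hσ (z i))).le
  | or φ θ h1 h2 =>
    simp only [NNF.relativize, eval, add_eq_max]
    exact max_le_max (h1 σ hσ) (h2 σ hσ)
  | and φ θ h1 h2 => exact mul_le_mul' (h1 σ hσ) (h2 σ hσ)
  | ex φ ih =>
    simp only [NNF.relativize, eval_bigOr]
    refine sum_le fun j hj => (ih _ (hsnoc hσ hj)).trans ?_
    rw [← snoc_comp]
    exact le_sum (fun b => (π.comap f).eval φ (Fin.snoc (y ∘ σ) b)) (Finset.mem_univ (y j))
  | all φ ih =>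
    simp only [NNF.relativize, eval_bigAnd]
    -- One index is kept for each element of `A`; the factors at the other indices are at most `1`.
    choose j hj hjy using hy'
    have hinj : Function.Injective j := fun a b h => by rw [← hjy a, h, hjy]
    refine (prod_le_prod_of_subset _
      (show Finset.univ.map ⟨j, hinj⟩ ⊆ J from fun x hx => ?_)).trans ?_
    · obtain ⟨a, -, rfl⟩ := Finset.mem_map.1 hx
      exact hj a
    · rw [Finset.prod_map]
      refine Finset.prod_le_prod' fun a _ => (ih _ (hsnoc hσ (hj a))).trans_eq ?_
      rw [← snoc_comp, hjy]

end Interp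

/-! ### The existential sentence and the main equivalence -/

namespace NNF

open MaxSemiring Interp

variable {L : FirstOrder.Language.{u, v}}

/-- The existential closure of a `Σ₁` formula. -/
theorem exists_isSigma1_isGreatest (S : Type s) [CommSemiring S] [LinearOrder S] [MaxSemiring S]
    {n : ℕ} (ϑ : NNF L n) (hϑ : ϑ.IsSigma1) :
    ∃ φ : NNF L 0, φ.IsSigma1 ∧ ∀ (B : Type w) [Fintype B] [Nonempty B] (π : Interp L S B),
      IsGreatest (Set.range fun x => π.eval ϑ x) (π.value φ) := by
  induction n with
  | zero =>
    refine ⟨ϑ, hϑ, fun B _ _ π => ⟨⟨_, rfl⟩, ?_⟩⟩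
    rintro _ ⟨x, rfl⟩
    rw [value, Subsingleton.elim x]
  | succ n ih =>
    obtain ⟨φ, hφ, h⟩ := ih (.ex ϑ) (.ex hϑ)
    refine ⟨φ, hφ, fun B _ _ π => ⟨?_, ?_⟩⟩
    · obtain ⟨x, hx⟩ := (h B π).1
      obtain ⟨b, -, hb⟩ := exists_sum_le Finset.univ_nonempty fun b => π.eval ϑ (Fin.snoc x b)
      refine ⟨Fin.snoc x b, hx ▸ le_antisymm ?_ hb⟩
      exact le_sum (fun b => π.eval ϑ (Fin.snoc x b)) (Finset.mem_univ b)
    · rintro _ ⟨x, rfl⟩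
      refine le_trans ?_ ((h B π).2 ⟨Fin.init x, rfl⟩)
      have := le_sum (fun b => π.eval ϑ (Fin.snoc (Fin.init x) b)) (Finset.mem_univ (x (Fin.last n)))
      rwa [Fin.snoc_init_self] at this

end NNF

open MaxSemiring Interp

/-- Since `A` may have fewer than `K` elements, only the variables in `J` enumerate it; the values
of `y` off `J` are irrelevant. -/
theorem Finset.exists_injOn_image_eq {B : Type*} [DecidableEq B] (A : Finset B) (hA : A.Nonempty)
    {K : ℕ} (hK : A.card ≤ K) :
    ∃ (J : Finset (Fin K)) (y : Fin K → A), Set.InjOn y J ∧ ∀ a, ∃ j ∈ J, y j = a := by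
  have : Nonempty A := hA.to_subtype
  let e : A ↪ Fin K := A.equivFin.toEmbedding.trans (Fin.castLEEmb hK)
  refine ⟨Finset.univ.map e, Function.invFun e, ?_, fun a => ⟨e a, by simp, ?_⟩⟩
  · intro x hx y hy h
    obtain ⟨a, -, rfl⟩ := Finset.mem_map.1 hx
    obtain ⟨b, -, rfl⟩ := Finset.mem_map.1 hy
    rw [Function.leftInverse_invFun e.injective, Function.leftInverse_invFun e.injective] at h
    rw [h]
  · exact Function.leftInverse_invFun e.injective a

theorem finExtPreserved_iff {L : FirstOrder.Language.{u, v}} (S : Type s) [CommSemiring S]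
    [LinearOrder S] [MaxSemiring S] (ψ : NNF L 0) :
    FinExtPreserved.{w} S ψ ↔ ∃ φ : NNF L 0, φ.IsSigma1 ∧ FinEquiv.{w} S ψ φ := by
  classical
  constructor
  · intro hψ
    -- The additional element keeps the small subinterpretation nonempty even when the bound is `0`.
    let K := ψ.witnessBound + 1
    -- The empty `J` would mean evaluation in the empty universe, about which preservation says
    -- nothing.
    let 𝒥 : Finset (Finset (Fin K)) := Finset.univ.filter Finset.Nonempty
    let ϑ : NNF L K := .bigOr (𝒥.toList.map fun J => ψ.relativize J Fin.elim0)
    have hϑ : ϑ.IsSigma1 := .of_quantifierFree <| NNF.bigOr_quantifierFree fun θ hθ => by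
      obtain ⟨J, -, rfl⟩ := List.mem_map.1 hθ
      exact NNF.relativize_quantifierFree _ _ _
    obtain ⟨φ, hφ, h⟩ := NNF.exists_isSigma1_isGreatest.{w} S ϑ hϑ
    refine ⟨φ, hφ, fun B _ _ π hπ => le_antisymm ?_ ?_⟩
    · obtain ⟨A, hA, hAcard, hle⟩ := exists_small_le hψ hπ
      obtain ⟨J, y, hy, hy'⟩ := A.exists_injOn_image_eq hA hAcard
      refine hle.trans (le_trans ?_ ((h B π).2 ⟨(↑) ∘ y, rfl⟩))
      simp only [ϑ, eval_bigOr]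
      have hJ : J ∈ 𝒥 := by
        obtain ⟨a, ha⟩ := hA
        obtain ⟨j, hj, -⟩ := hy' ⟨a, ha⟩
        simpa [𝒥] using ⟨j, hj⟩
      refine le_trans (le_of_eq ?_)
        (le_sum (fun J => π.eval (ψ.relativize J Fin.elim0) ((↑) ∘ y)) hJ)
      rw [eval_relativize π Subtype.val_injective hy hy', value]
      congr 1
      exact Subsingleton.elim _ _
    · obtain ⟨x, hx⟩ := (h B π).1
      rw [← hx]
      simp only [ϑ, eval_bigOr]
      refine sum_le fun J hJ => ?_
      obtain ⟨j0, hj0⟩ := (Finset.mem_filter.1 hJ).2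
      let A := J.image x
      have hA : A.Nonempty := ⟨x j0, Finset.mem_image_of_mem x hj0⟩
      have := hA.to_subtype
      let y : Fin K → A := fun j =>
        if hj : j ∈ J then ⟨x j, Finset.mem_image_of_mem x hj⟩ else Classical.arbitrary A
      have hxy : ∀ j ∈ J, (y j : B) = x j := fun j hj => by simp [y, hj]
      have hy' : ∀ a, ∃ j ∈ J, y j = a := by
        rintro ⟨a, ha⟩
        obtain ⟨j, hj, rfl⟩ := Finset.mem_image.1 ha
        exact ⟨j, hj, Subtype.ext (hxy j hj)⟩
      refine (eval_relativize_le π Subtype.val_injective hxy hy' ψ Fin.elim0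
        fun i => i.elim0).trans ?_
      refine le_trans (le_of_eq ?_)
        (value_comap_le_of_finExtPreserved hψ hπ (Subtype.val_injective : Function.Injective
          ((↑) : A → B)))
      rw [value]
      congr 1
      exact Subsingleton.elim _ _
  · rintro ⟨φ, hφ, h⟩ B _ A πA πB hA hπA hπB hsub
    have := hA.to_subtype
    have : Nonempty B := hA.to_type
    rw [natLE_iff, h A πA hπA, h B πB hπB, hsub.eq_comap]
    refine (eval_comap_le_of_isSigma1 πB Subtype.val_injective hφ _).trans_eq ?_
    rw [value]
    congr 1
    exact Subsingleton.elim _ _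

theorem mainTheorem2 (L : FirstOrder.Language.{u, v}) [L.IsRelational] (ψ : NNF L 0) :
    (FinExtPreserved.{w} Viterbi ψ ↔
      ∃ φ : NNF L 0, φ.IsSigma1 ∧ FinEquiv.{w} Viterbi ψ φ) ∧
    (FinExtPreserved.{w} TropicalSemiring ψ ↔
      ∃ φ : NNF L 0, φ.IsSigma1 ∧ FinEquiv.{w} TropicalSemiring ψ φ) ∧
    (FinExtPreserved.{w} Lukasiewicz ψ ↔
      ∃ φ : NNF L 0, φ.IsSigma1 ∧ FinEquiv.{w} Lukasiewicz ψ φ) ∧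
    (FinExtPreserved.{w} Doubt ψ ↔
      ∃ φ : NNF L 0, φ.IsSigma1 ∧ FinEquiv.{w} Doubt ψ φ) :=
  -- Both sides mention only the semiring structure, so the reversed order on `NaturalTropical`
  -- leaves no trace in the tropical case.
  ⟨finExtPreserved_iff Viterbi ψ, finExtPreserved_iff NaturalTropical ψ,
    finExtPreserved_iff Lukasiewicz ψ, finExtPreserved_iff Doubt ψ⟩
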